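/- Let $n\ge 0$, equip $\mathbb{R}^{2n}=\mathbb{R}^n_x\times\mathbb{R}^n_p$ with $\sigma(z,z')=Jz\cdot z'$, $J=\begin{pmatrix}0&I\\-I&0\end{pmatrix}$, and let $S\in\operatorname{Sp}(n)$ satisfy $\det(S-I)\ne0$ and $\det(S+I)\neq 0$. Let $M_S=\tfrac12J(S+I)(S-I)^{-1}$ be the symplectic Cayley transform of $S$ (a symmetric matrix), let $\operatorname{sign}M_S$ be its signature (number of positive minus number of negative eigenvalues), and put $M_{-S}=\tfrac12J(S-I)(S+I)^{-1}$. For $\nu\in\mathbb{Z}$ and $\hbar>0$, let $\widetilde S$ be the phase space operator $$\widetilde SF(z)=\Big(\frac1{2\pi\hbar}\Big)^{n}\frac{i^{\nu}}{\sqrt{|\det(S-I)|}}\int_{\mathbb{R}^{2n}}e^{\frac i{2\hbar}M_Sz_0\cdot z_0}\,\widetilde T(z_0)F(z)\,dz_0,\qquad \widetilde T(z_0)F(z)=e^{-\frac i\hbar\sigma(z,z_0)}F(z-\tfrac12z_0)$$ (when $\nu$ is the Conley--Zehnder index of a metaplectic operator $\widehat S$ with projection $S$, this is the phase space representation of $\widehat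 S$). Then for every integer $\nu$, every $F\in C_0^\infty(\mathbb{R}^{2n},\mathbb{C})$ and every $z\in\mathbb{R}^{2n}$, as $\hbar\to0^+$, $$\widetilde SF(z)=\frac{2^{n}\,i^{\,\nu+\frac12\operatorname{sign}M_S}}{\sqrt{|\det(S+I)|}}\,\exp\Big(\frac{2i}{\hbar}M_{-S}z\cdot z\Big)\,F\big(z-\tfrac12M_S^{-1}Jz\big)+O(\hbar),$$ where $i^{t}=e^{i\pi t/2}$ for real $t$. -/

import Mathlib

open Filter Topology MeasureTheory
open scoped Matrix ContDiff

namespace BoppMetaplectic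

/-- The phase space `ℝ_x^n × ℝ_p^n`; `Sum.inl` indexes positions, `Sum.inr` momenta. -/
abbrev PhaseSpace (n : ℕ) : Type := Fin n ⊕ Fin n → ℝ

/-- Real `2n × 2n` matrices, in `n × n` blocks. -/
abbrev PhaseMatrix (n : ℕ) : Type := Matrix (Fin n ⊕ Fin n) (Fin n ⊕ Fin n) ℝ

/-- The standard symplectic matrix `J = (0, I; -I, 0)`. This is the negative of `Matrix.J`; both
define the same group `Matrix.symplecticGroup`. -/
def stdJ (n : ℕ) : PhaseMatrix n := Matrix.fromBlocks 0 1 (-1) 0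

/-- The standard symplectic form `σ(z, z') = Jz · z'`. -/
def symplecticForm {n : ℕ} (z z' : PhaseSpace n) : ℝ := (stdJ n *ᵥ z) ⬝ᵥ z'

/-- The symplectic Cayley transform `M_S = ½ J (S + I) (S - I)⁻¹` (for `det (S - I) ≠ 0`). -/
noncomputable def cayley {n : ℕ} (S : PhaseMatrix n) : PhaseMatrix n :=
  (1 / 2 : ℝ) • (stdJ n * (S + 1) * (S - 1)⁻¹)

/-- The signature of a real symmetric matrix: the number of positive eigenvalues minus the number
of negative eigenvalues, with multiplicity (all roots of the characteristic polynomial of such a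
matrix are real). -/
noncomputable def signature {ι : Type*} [Fintype ι] [DecidableEq ι] (A : Matrix ι ι ℝ) : ℤ :=
  (Multiset.countP (fun t : ℝ => 0 < t) A.charpoly.roots : ℤ)
    - (Multiset.countP (fun t : ℝ => t < 0) A.charpoly.roots : ℤ)

/-- The phase space displacement operator
`T̃(z₀)F(z) = exp (-(i/ħ) σ(z, z₀)) F(z - z₀/2)`. -/
noncomputable def displacement {n : ℕ} (ħ : ℝ) (z₀ : PhaseSpace n) (F : PhaseSpace n → ℂ) :
    PhaseSpace n → ℂ :=
  fun z => Complex.exp (-(Complex.I / (ħ : ℂ)) * (symplecticForm z z₀ : ℂ)) *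
    F (z - (1 / 2 : ℝ) • z₀)

/-- The Bopp operator with twisted symbol `a`:
`ÃF(z) = (2πħ)⁻ⁿ ∫ a(z₀) T̃(z₀)F(z) dz₀`. -/
noncomputable def boppOperator {n : ℕ} (ħ : ℝ) (a : PhaseSpace n → ℂ) (F : PhaseSpace n → ℂ) :
    PhaseSpace n → ℂ :=
  fun z => ((1 / (2 * Real.pi * ħ) : ℝ) : ℂ) ^ n * ∫ z₀ : PhaseSpace n, a z₀ * displacement ħ z₀ F z

/-- The twisted Weyl symbol of the metaplectic operator with projection `S` and index `ν`:
`i^ν |det (S - I)|^(-1/2) exp ((i/2ħ) M_S z·z)`. -/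
noncomputable def twistedSymbol {n : ℕ} (ħ : ℝ) (S : PhaseMatrix n) (ν : ℤ) : PhaseSpace n → ℂ :=
  fun z => Complex.I ^ ν / (Real.sqrt |(S - 1).det| : ℂ) *
    Complex.exp (Complex.I / (2 * (ħ : ℂ)) * (((cayley S *ᵥ z) ⬝ᵥ z : ℝ) : ℂ))

/-- The phase space metaplectic operator `S̃` with projection `S` and index `ν`. -/
noncomputable def extendedMetaplectic {n : ℕ} (ħ : ℝ) (S : PhaseMatrix n) (ν : ℤ)
    (F : PhaseSpace n → ℂ) : PhaseSpace n → ℂ :=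
  boppOperator ħ (twistedSymbol ħ S ν) F

end BoppMetaplectic

/-! For fixed `z` the integrand of `S̃F(z)` has phase `(1/2ħ)(M_S z₀·z₀ - 2σ(z, z₀))`, quadratic in
`z₀`, with the single critical point `w = M_S⁻¹Jz`. Translating by `w` completes the square exactly
(`cayley_phase_add`): since `J M_S⁻¹ J = 4 M_{-S}`, the critical value yields the unimodular factor
`exp((2i/ħ) M_{-S}z·z)`, and what remains is a Gaussian oscillatory integral of `y ↦ F(z - (w +
y)/2)`.

Stationary phase for a nondegenerate symmetric matrix (`isBigO_quadratic_stationaryPhase`) evaluates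
it up to `O(ħ)`. An orthogonal change of variables diagonalizes the phase; Parseval turns the
Gaussian into one with phase of size `ħ` on the Fourier side, where replacing it by `1` costs `O(ħ)`
and leaves `∫ 𝓕⁻g = g(0)`. Each eigenvalue contributes `e^{±iπ/4}`, which together give `i^{sign M_S
/ 2}`; the determinants combine in `stationaryPhase_prefactor`. -/

namespace BoppMetaplectic

/-! ### Stationary phase for diagonal quadratic phases. -/

section StationaryPhase

open scoped FourierTransform SchwartzMap

variable {ι : Type*} [Fintype ι]

theorem integrable_cexp_neg_sum_sq {b : ι → ℂ} (hb : ∀ i, 0 < (b i).re) :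
    Integrable (fun x : EuclideanSpace ℝ ι => Complex.exp (-∑ i, b i * (x i : ℂ) ^ 2)) := by
  rw [← (PiLp.volume_preserving_toLp ι).integrable_comp_emb
    (MeasurableEquiv.toLp 2 _).measurableEmbedding]
  simpa [Function.comp_def] using GaussianFourier.integrable_cexp_neg_sum_mul_add hb 0

/-- The Fourier transform of a diagonal complex Gaussian. -/
theorem fourier_cexp_neg_sum_sq {b : ι → ℂ} (hb : ∀ i, 0 < (b i).re) (ξ : EuclideanSpace ℝ ι) :
    𝓕 (fun x : EuclideanSpace ℝ ι => Complex.exp (-∑ i, b i * (x i : ℂ) ^ 2)) ξ =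
      (∏ i, ((Real.pi : ℂ) / b i) ^ (1 / 2 : ℂ)) *
        Complex.exp (-∑ i, (Real.pi : ℂ) ^ 2 / b i * (ξ i : ℂ) ^ 2) := by
  have hb0 (i : ι) : b i ≠ 0 := fun h => by simpa [h] using hb i
  rw [Real.fourier_eq', ← (PiLp.volume_preserving_toLp ι).integral_comp
    (MeasurableEquiv.toLp 2 _).measurableEmbedding]
  have h := GaussianFourier.integral_cexp_neg_sum_mul_add hb
    (fun i => -2 * (Real.pi : ℂ) * Complex.I * (ξ i : ℂ))
  rw [Finset.prod_mul_distrib, ← Complex.exp_sum] at h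
  convert h using 1
  · congr 1
    ext x
    rw [smul_eq_mul, ← Complex.exp_add, add_comm]
    congr 2
    simp only [PiLp.inner_apply, RCLike.inner_apply, conj_trivial]
    push_cast
    rw [Finset.mul_sum, Finset.sum_mul]
    exact Finset.sum_congr rfl fun i _ => by ring
  · congr 2
    rw [← Finset.sum_neg_distrib]
    refine Finset.sum_congr rfl fun i _ => ?_
    have := hb0 i
    field_simp
    linear_combination (4 * (ξ i : ℂ) ^ 2) * Complex.I_sq.symm

/-- Parseval's formula against a diagonal complex Gaussian. -/
theorem integral_cexp_neg_sum_sq_mul {b : ι → ℂ} (hb : ∀ i, 0 < (b i).re)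
    (g : 𝓢(EuclideanSpace ℝ ι, ℂ)) :
    ∫ x, Complex.exp (-∑ i, b i * (x i : ℂ) ^ 2) * g x =
      (∏ i, ((Real.pi : ℂ) / b i) ^ (1 / 2 : ℂ)) *
        ∫ ξ, Complex.exp (-∑ i, (Real.pi : ℂ) ^ 2 / b i * (ξ i : ℂ) ^ 2) * 𝓕⁻ g ξ := by
  have h := VectorFourier.integral_fourierIntegral_smul_eq_flip (μ := volume) (ν := volume)
    (L := innerₗ (EuclideanSpace ℝ ι)) Real.continuous_fourierChar continuous_inner
    (integrable_cexp_neg_sum_sq hb) (𝓕⁻ g : 𝓢(EuclideanSpace ℝ ι, ℂ)).integrable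
  have hL : ∀ ξ, VectorFourier.fourierIntegral Real.fourierChar volume
      (innerₗ (EuclideanSpace ℝ ι)) (fun x => Complex.exp (-∑ i, b i * (x i : ℂ) ^ 2)) ξ = _ :=
    fourier_cexp_neg_sum_sq hb
  have hR : ∀ x, VectorFourier.fourierIntegral Real.fourierChar volume
      (innerₗ (EuclideanSpace ℝ ι)).flip (𝓕⁻ g : 𝓢(EuclideanSpace ℝ ι, ℂ)) x = g x := by
    intro x
    rw [flip_innerₗ]
    exact congrArg (fun f : 𝓢(EuclideanSpace ℝ ι, ℂ) => f x) 
      (FourierTransform.fourier_fourierInv_eq (F := 𝓢(EuclideanSpace ℝ ι, ℂ)) g)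
  simp only [hL, hR, smul_eq_mul] at h
  rw [← h, ← integral_const_mul]
  exact integral_congr_ae (.of_forall fun x => by ring)

theorem norm_cexp_neg_sum_sq_le_one {b : ι → ℂ} (hb : ∀ i, 0 ≤ (b i).re) (x : ι → ℝ) :
    ‖Complex.exp (-∑ i, b i * (x i : ℂ) ^ 2)‖ ≤ 1 := by
  rw [Complex.norm_exp, Real.exp_le_one_iff, Complex.neg_re, neg_nonpos, Complex.re_sum]
  refine Finset.sum_nonneg fun i _ => ?_
  rw [← Complex.ofReal_pow, Complex.re_mul_ofReal]
  exact mul_nonneg (hb i) (sq_nonneg _)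

/-- Dominated convergence with bound `‖g‖`. It carries Parseval from damped Gaussians to the
limiting oscillating ones, which are not integrable by themselves. -/
theorem tendsto_integral_cexp_neg_sum_sq_mul {b : ℝ → ι → ℂ} {c : ι → ℂ}
    (hb : ∀ᶠ t in 𝓝[>] (0 : ℝ), ∀ i, 0 ≤ (b t i).re)
    (hlim : ∀ i, Tendsto (fun t => b t i) (𝓝[>] 0) (𝓝 (c i)))
    (g : 𝓢(EuclideanSpace ℝ ι, ℂ)) :
    Tendsto (fun t => ∫ x, Complex.exp (-∑ i, b t i * (x i : ℂ) ^ 2) * g x) (𝓝[>] 0)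
      (𝓝 (∫ x, Complex.exp (-∑ i, c i * (x i : ℂ) ^ 2) * g x)) := by
  refine tendsto_integral_filter_of_dominated_convergence (fun x => ‖g x‖) ?_ ?_
    g.integrable.norm ?_
  · refine .of_forall fun t => Continuous.aestronglyMeasurable ?_
    have := g.continuous
    fun_prop
  · filter_upwards [hb] with t ht
    refine .of_forall fun x => ?_
    rw [norm_mul]
    exact mul_le_of_le_one_left (norm_nonneg _) (norm_cexp_neg_sum_sq_le_one ht _)
  · refine .of_forall fun x => ?_
    refine Tendsto.mul_const _ ((Complex.continuous_exp.tendsto _).comp ?_)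
    exact (tendsto_finsetSum _ fun i _ => (hlim i).mul_const _).neg

/-- Parseval's formula against a diagonal oscillating Gaussian. -/
theorem integral_cexp_I_sum_sq_mul {a : ι → ℝ} (ha : ∀ i, a i ≠ 0)
    (g : 𝓢(EuclideanSpace ℝ ι, ℂ)) :
    ∫ x, Complex.exp (-∑ i, (-(Complex.I * a i)) * (x i : ℂ) ^ 2) * g x =
      (∏ i, ((Real.pi : ℂ) / (-(Complex.I * a i))) ^ (1 / 2 : ℂ)) *
        ∫ ξ, Complex.exp (-∑ i, (Real.pi : ℂ) ^ 2 / (-(Complex.I * a i)) * (ξ i : ℂ) ^ 2) *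
          𝓕⁻ g ξ := by
  -- Damping by `t > 0` makes the Gaussian integrable; both sides of Parseval are then followed as
  -- `t → 0⁺`.
  let b : ℝ → ι → ℂ := fun t i => t - Complex.I * a i
  have hbre (t : ℝ) (i : ι) : (b t i).re = t := by simp [b]
  have hlim (i : ι) : Tendsto (fun t => b t i) (𝓝[>] 0) (𝓝 (-(Complex.I * a i))) := by
    have h : Continuous fun t => b t i := by simp only [b]; fun_prop
    simpa [b] using (h.tendsto 0).mono_left nhdsWithin_le_nhds
  have hne (i : ι) : -(Complex.I * a i) ≠ 0 := by simpa using ha i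
  have hl := tendsto_integral_cexp_neg_sum_sq_mul (b := b)
    (by filter_upwards [self_mem_nhdsWithin] with t ht i using (hbre t i).symm ▸ le_of_lt ht)
    hlim g
  have hr := tendsto_integral_cexp_neg_sum_sq_mul (b := fun t i => (Real.pi : ℂ) ^ 2 / b t i)
    (c := fun i => (Real.pi : ℂ) ^ 2 / (-(Complex.I * a i)))
    (by
      filter_upwards [self_mem_nhdsWithin] with t ht i
      rw [← Complex.ofReal_pow, Complex.div_re]
      simp only [Complex.ofReal_re, Complex.ofReal_im, hbre, zero_mul, zero_div, add_zero]
      have : (0 : ℝ) < t := ht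
      have := Complex.normSq_nonneg (b t i)
      positivity)
    (fun i => tendsto_const_nhds.div (hlim i) (hne i)) (𝓕⁻ g)
  have hp : Tendsto (fun t => ∏ i, ((Real.pi : ℂ) / b t i) ^ (1 / 2 : ℂ)) (𝓝[>] 0)
      (𝓝 (∏ i, ((Real.pi : ℂ) / (-(Complex.I * a i))) ^ (1 / 2 : ℂ))) := by
    refine tendsto_finsetProd _ fun i _ => ?_
    -- The limit `iπ / a i` is a nonzero imaginary number, so it avoids the branch cut of the square
    -- root.
    refine (tendsto_const_nhds.div (hlim i) (hne i)).cpow tendsto_const_nhds (Or.inr ?_)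
    simp [Complex.div_im, ha i, Real.pi_ne_zero]
  refine tendsto_nhds_unique hl ((hp.mul hr).congr' ?_)
  filter_upwards [self_mem_nhdsWithin] with t ht
  exact (integral_cexp_neg_sum_sq_mul (fun i => (hbre t i).symm ▸ ht) g).symm

/-- The base is a positive real times `i·sign l`, whose principal square root is `e^{iπ sign(l)/4}`.
This is the source of the signature. -/
theorem cpow_half_pi_div_neg_I_mul {ħ l : ℝ} (hħ : 0 < ħ) (hl : l ≠ 0) :
    ((Real.pi : ℂ) / (-(Complex.I * ((l / (2 * ħ) : ℝ) : ℂ)))) ^ (1 / 2 : ℂ) =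
      Real.sqrt (2 * Real.pi * ħ) *
        (Complex.exp (Real.pi * Complex.I / 4 * (SignType.sign l : ℝ)) / Real.sqrt |l|) := by
  have hr : 0 < 2 * Real.pi * ħ / |l| := by have := abs_pos.2 hl; positivity
  have hs : (Real.sqrt (2 * Real.pi * ħ) : ℂ) *
      (Complex.exp (Real.pi * Complex.I / 4 * (SignType.sign l : ℝ)) / Real.sqrt |l|) =
      ((2 * Real.pi * ħ / |l| : ℝ) : ℂ) ^ (1 / 2 : ℂ) *
        Complex.exp (Real.pi * Complex.I / 4 * (SignType.sign l : ℝ)) := by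
    rw [show (1 / 2 : ℂ) = ((1 / 2 : ℝ) : ℂ) by push_cast; rfl, ← Complex.ofReal_cpow hr.le,
      ← Real.sqrt_eq_rpow, Real.sqrt_div (by positivity)]
    push_cast
    ring
  rw [hs]
  have hx : (Real.pi : ℂ) / (-(Complex.I * ((l / (2 * ħ) : ℝ) : ℂ))) =
      ((2 * Real.pi * ħ / |l| : ℝ) : ℂ) * (Complex.I * (SignType.sign l : ℝ)) := by
    have h1 : (l : ℂ) ≠ 0 := by exact_mod_cast hl
    have h2 : (ħ : ℂ) ≠ 0 := by exact_mod_cast hħ.ne'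
    have h3 : ((|l| : ℝ) : ℂ) = l * (SignType.sign l : ℝ) := by
      rw [← Complex.ofReal_mul, self_mul_sign]
    have h4 : ((SignType.sign l : ℝ) : ℂ) ≠ 0 := by
      intro h; rw [h, mul_zero] at h3; exact hl (by simpa using h3)
    rw [Complex.ofReal_div l, Complex.ofReal_div _ |l|, h3]
    push_cast
    rw [div_eq_iff (by simp [h1, h2])]
    field_simp
    simp
  rw [hx]
  have hr' : ((2 * Real.pi * ħ / |l| : ℝ) : ℂ) ≠ 0 := by exact_mod_cast hr.ne'
  rcases hl.lt_or_gt with h | h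
  · rw [sign_neg h]
    rw [Complex.cpow_def_of_ne_zero (by simpa using hr'), Complex.cpow_def_of_ne_zero hr',
      Complex.log_ofReal_mul hr (by simp), ← Complex.exp_add, Complex.ofReal_log hr.le]
    simp only [SignType.coe_neg_one, Complex.ofReal_neg, Complex.ofReal_one, mul_neg, mul_one,
      Complex.log_neg_I]
    ring_nf
  · rw [sign_pos h]
    rw [Complex.cpow_def_of_ne_zero (by simpa using hr'), Complex.cpow_def_of_ne_zero hr',
      Complex.log_ofReal_mul hr (by simp), ← Complex.exp_add, Complex.ofReal_log hr.le]
    simp only [SignType.coe_one, Complex.ofReal_one, mul_one, Complex.log_I]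
    ring_nf

/-- From `|e^{iθ} - 1| ≤ |θ|` with `θ` quadratic in `ξ`, and the finite second moment of a Schwartz
function. -/
theorem norm_integral_cexp_mul_sub_integral_le (c : ι → ℝ) (h : 𝓢(EuclideanSpace ℝ ι, ℂ)) :
    ∃ C, ∀ ħ : ℝ, 0 < ħ →
      ‖(∫ ξ, Complex.exp (Complex.I * ((ħ * ∑ i, c i * ξ i ^ 2 : ℝ) : ℂ)) * h ξ) - ∫ ξ, h ξ‖
        ≤ C * ħ := by
  have hint := (h.integrable_pow_mul volume 2).const_mul (∑ i, |c i|)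
  refine ⟨∫ ξ, (∑ i, |c i|) * (‖ξ‖ ^ 2 * ‖h ξ‖), fun ħ hħ => ?_⟩
  have hexp : Integrable fun ξ : EuclideanSpace ℝ ι =>
      Complex.exp (Complex.I * ((ħ * ∑ i, c i * ξ i ^ 2 : ℝ) : ℂ)) * h ξ := by
    refine h.integrable.norm.mono' (Continuous.aestronglyMeasurable ?_) (.of_forall fun ξ => ?_)
    · have := h.continuous
      fun_prop
    · rw [norm_mul, mul_comm Complex.I, Complex.norm_exp_ofReal_mul_I, one_mul]
  rw [← integral_sub hexp h.integrable, mul_comm, ← integral_const_mul]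
  refine norm_integral_le_of_norm_le (hint.const_mul ħ) (.of_forall fun ξ => ?_)
  rw [← sub_one_mul, norm_mul, ← mul_assoc (∑ i, |c i|), ← mul_assoc ħ]
  refine mul_le_mul_of_nonneg_right ?_ (norm_nonneg _)
  refine Real.norm_exp_I_mul_ofReal_sub_one_le.trans ?_
  rw [norm_mul, Real.norm_of_nonneg hħ.le]
  refine mul_le_mul_of_nonneg_left ?_ hħ.le
  rw [Finset.sum_mul]
  refine norm_sum_le_of_le _ fun i _ => ?_
  rw [norm_mul, norm_pow, Real.norm_eq_abs]
  gcongr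
  exact PiLp.norm_apply_le ξ i

/-- Stationary phase with a diagonal quadratic phase. -/
theorem isBigO_diagonal_stationaryPhase {l : ι → ℝ} (hl : ∀ i, l i ≠ 0)
    (g : 𝓢(EuclideanSpace ℝ ι, ℂ)) :
    (fun ħ : ℝ => (1 / (Real.sqrt (2 * Real.pi * ħ) : ℂ)) ^ Fintype.card ι *
        (∫ x, Complex.exp (Complex.I / (2 * (ħ : ℂ)) * ((∑ i, l i * x i ^ 2 : ℝ) : ℂ)) * g x) -
      (∏ i, Complex.exp (Real.pi * Complex.I / 4 * (SignType.sign (l i) : ℝ)) /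
        Real.sqrt |l i|) * g 0) =O[𝓝[>] (0 : ℝ)] (fun ħ : ℝ => ħ) := by
  -- These coefficients come from `-π² / (-i l/(2ħ)) = iħ·(-2π²/l)`, the exponent of the transformed
  -- Gaussian.
  obtain ⟨C, hC⟩ := norm_integral_cexp_mul_sub_integral_le
    (fun i => -(2 * Real.pi ^ 2 / l i)) (𝓕⁻ g)
  set K : ℂ := ∏ i, Complex.exp (Real.pi * Complex.I / 4 * (SignType.sign (l i) : ℝ)) /
        Real.sqrt |l i| with hK
  -- Fourier inversion evaluated at the origin.
  have hg0 : ∫ ξ, 𝓕⁻ g ξ = g 0 := by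
    have : 𝓕 (𝓕⁻ g : 𝓢(EuclideanSpace ℝ ι, ℂ)) 0 = g 0 := by
      rw [FourierTransform.fourier_fourierInv_eq]
    rw [← this, SchwartzMap.fourier_coe, Real.fourier_eq']
    simp
  refine Asymptotics.IsBigO.of_bound (‖K‖ * C) ?_
  filter_upwards [self_mem_nhdsWithin] with ħ (hħ : 0 < ħ)
  have hħ' : (ħ : ℂ) ≠ 0 := by exact_mod_cast hħ.ne'
  have hs : (Real.sqrt (2 * Real.pi * ħ) : ℂ) ≠ 0 := by
    have : 0 < Real.sqrt (2 * Real.pi * ħ) := by positivity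
    exact_mod_cast this.ne'
  have h := integral_cexp_I_sum_sq_mul (a := fun i => l i / (2 * ħ))
    (fun i => div_ne_zero (hl i) (by positivity)) g
  simp only [cpow_half_pi_div_neg_I_mul hħ (hl _)] at h
  rw [Finset.prod_mul_distrib, Finset.prod_const, Finset.card_univ, ← hK] at h
  have e1 (x : EuclideanSpace ℝ ι) :
      -∑ i, (-(Complex.I * ((l i / (2 * ħ) : ℝ) : ℂ))) * (x i : ℂ) ^ 2 =
        Complex.I / (2 * (ħ : ℂ)) * ((∑ i, l i * x i ^ 2 : ℝ) : ℂ) := by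
    push_cast
    rw [Finset.mul_sum, ← Finset.sum_neg_distrib]
    exact Finset.sum_congr rfl fun i _ => by field_simp
  have e2 (x : EuclideanSpace ℝ ι) :
      -∑ i, (Real.pi : ℂ) ^ 2 / (-(Complex.I * ((l i / (2 * ħ) : ℝ) : ℂ))) * (x i : ℂ) ^ 2 =
        Complex.I * ((ħ * ∑ i, -(2 * Real.pi ^ 2 / l i) * x i ^ 2 : ℝ) : ℂ) := by
    push_cast
    rw [Finset.mul_sum, Finset.mul_sum, ← Finset.sum_neg_distrib]
    refine Finset.sum_congr rfl fun i _ => ?_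
    have : (l i : ℂ) ≠ 0 := by exact_mod_cast hl i
    field_simp
    simp
  simp only [e1, e2] at h
  have hp : (1 / (Real.sqrt (2 * Real.pi * ħ) : ℂ)) ^ Fintype.card ι *
      (Real.sqrt (2 * Real.pi * ħ) : ℂ) ^ Fintype.card ι = 1 := by
    rw [← mul_pow, one_div_mul_cancel hs, one_pow]
  rw [h, ← hg0, ← mul_assoc, ← mul_assoc, hp, one_mul, ← mul_sub, norm_mul, mul_assoc,
    Real.norm_of_nonneg hħ.le]
  exact mul_le_mul_of_nonneg_left (hC ħ hħ) (norm_nonneg _)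

end StationaryPhase

/-! ### Diagonalization: signature, determinant and general quadratic phases. -/

section Signature

variable {ι : Type*} [Fintype ι] [DecidableEq ι] {A : Matrix ι ι ℝ}

theorem signature_eq_sum_sign (hA : A.IsHermitian) :
    (signature A : ℝ) = ∑ i, ((SignType.sign (hA.eigenvalues i) : SignType) : ℝ) := by
  have h (x : ℝ) : ((SignType.sign x : SignType) : ℝ) =
      (if 0 < x then 1 else 0) - (if x < 0 then 1 else 0) := by
    rcases lt_trichotomy x 0 with hx | hx | hx
    · simp [hx, hx.not_gt]
    · simp [hx]
    · simp [hx, hx.not_gt]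
  simp only [signature, hA.roots_charpoly_eq_eigenvalues, Multiset.countP_map, h,
    Finset.sum_sub_distrib, Finset.sum_boole]
  push_cast
  rfl

theorem prod_exp_sign_div_sqrt_eigenvalues (hA : A.IsHermitian) :
    ∏ i, Complex.exp (Real.pi * Complex.I / 4 * (SignType.sign (hA.eigenvalues i) : ℝ)) /
        Real.sqrt |hA.eigenvalues i| =
      Complex.exp (Real.pi * Complex.I / 4 * signature A) / Real.sqrt |A.det| := by
  rw [Finset.prod_div_distrib, ← Complex.exp_sum, ← Finset.mul_sum, hA.det_eq_prod_eigenvalues,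
    ← Complex.ofReal_intCast, signature_eq_sum_sign hA, ← Complex.ofReal_prod]
  simp only [RCLike.ofReal_real_eq_id, id, Finset.abs_prod]
  rw [Real.sqrt_prod _ fun i _ => abs_nonneg _]
  push_cast
  rfl

theorem mulVec_dotProduct_eigenvectorBasis_repr_symm (hA : A.IsHermitian)
    (x : EuclideanSpace ℝ ι) :
    (A *ᵥ (hA.eigenvectorBasis.repr.symm x).ofLp) ⬝ᵥ (hA.eigenvectorBasis.repr.symm x).ofLp =
      ∑ i, hA.eigenvalues i * x i ^ 2 := by
  set y := hA.eigenvectorBasis.repr.symm x with hy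
  have hx (i : ι) : x i = inner ℝ (hA.eigenvectorBasis i) y := by
    rw [← OrthonormalBasis.repr_apply_apply, hy, LinearIsometryEquiv.apply_symm_apply]
  have h1 : (A *ᵥ y.ofLp) ⬝ᵥ y.ofLp = inner ℝ y (WithLp.toLp 2 (A *ᵥ y.ofLp)) := by
    simp [EuclideanSpace.inner_eq_star_dotProduct]
  have h2 (i : ι) : inner ℝ (hA.eigenvectorBasis i) (WithLp.toLp 2 (A *ᵥ y.ofLp)) =
      hA.eigenvalues i * x i := by
    have hT : Aᵀ = A := by simpa [Matrix.IsHermitian] using hA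
    rw [hx, EuclideanSpace.inner_eq_star_dotProduct, EuclideanSpace.inner_eq_star_dotProduct,
      star_trivial, dotProduct_comm, Matrix.dotProduct_mulVec, ← Matrix.mulVec_transpose, hT,
      hA.mulVec_eigenvectorBasis, smul_dotProduct, smul_eq_mul, dotProduct_comm]
  rw [h1, ← OrthonormalBasis.sum_inner_mul_inner hA.eigenvectorBasis]
  refine Finset.sum_congr rfl fun i _ => ?_
  rw [h2, real_inner_comm, ← hx]
  ring

/-- Stationary phase with a nondegenerate quadratic phase. -/
theorem isBigO_quadratic_stationaryPhase (hA : A.IsHermitian) (hdet : A.det ≠ 0)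
    {g : (ι → ℝ) → ℂ} (hg : ContDiff ℝ ∞ g) (hg_supp : HasCompactSupport g) :
    (fun ħ : ℝ => (1 / (Real.sqrt (2 * Real.pi * ħ) : ℂ)) ^ Fintype.card ι *
        (∫ y, Complex.exp (Complex.I / (2 * (ħ : ℂ)) * (((A *ᵥ y) ⬝ᵥ y : ℝ) : ℂ)) * g y) -
      Complex.exp (Real.pi * Complex.I / 4 * signature A) / Real.sqrt |A.det| * g 0)
      =O[𝓝[>] (0 : ℝ)] (fun ħ : ℝ => ħ) := by
  -- Eigenvector coordinates: an isometry, hence volume preserving, that fixes the origin and makes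
  -- the phase diagonal.
  let e : EuclideanSpace ℝ ι ≃L[ℝ] (ι → ℝ) :=
    hA.eigenvectorBasis.repr.symm.toContinuousLinearEquiv.trans (EuclideanSpace.equiv ι ℝ)
  have he (x : EuclideanSpace ℝ ι) : e x = (hA.eigenvectorBasis.repr.symm x).ofLp := rfl
  have hmp : MeasurePreserving e volume volume :=
    (PiLp.volume_preserving_ofLp ι).comp hA.eigenvectorBasis.repr.symm.measurePreserving
  have hl (i : ι) : hA.eigenvalues i ≠ 0 := fun h => hdet <| by
    rw [hA.det_eq_prod_eigenvalues]
    exact Finset.prod_eq_zero (Finset.mem_univ i) (by simp [h])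
  have hge : ContDiff ℝ ∞ (g ∘ e) := hg.comp e.contDiff
  have hge_supp : HasCompactSupport (g ∘ e) := hg_supp.comp_homeomorph e.toHomeomorph
  have h := isBigO_diagonal_stationaryPhase hl (hge_supp.toSchwartzMap hge)
  rw [prod_exp_sign_div_sqrt_eigenvalues hA] at h
  refine h.congr_left fun ħ => ?_
  rw [← hmp.integral_comp e.toHomeomorph.measurableEmbedding]
  have h0 : hge_supp.toSchwartzMap hge 0 = g 0 := by
    change g (e 0) = g 0
    rw [map_zero]
  rw [h0]
  congr 2
  refine integral_congr_ae (.of_forall fun x => ?_)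
  simp only [he, mulVec_dotProduct_eigenvectorBasis_repr_symm hA]
  rfl

end Signature

/-! ### Algebra of the symplectic Cayley transform. -/

section Cayley

variable {n : ℕ} {S : PhaseMatrix n}

theorem stdJ_eq_neg_J (n : ℕ) : stdJ n = -Matrix.J (Fin n) ℝ := by
  simp [stdJ, Matrix.J, Matrix.fromBlocks_neg]

theorem stdJ_transpose (n : ℕ) : (stdJ n)ᵀ = -stdJ n := by
  rw [stdJ_eq_neg_J, Matrix.transpose_neg, Matrix.J_transpose]

theorem abs_det_stdJ (n : ℕ) : |(stdJ n).det| = 1 := by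
  have h : (stdJ n).det * (stdJ n).det = 1 := by
    rw [← Matrix.det_mul, stdJ_eq_neg_J, neg_mul_neg, Matrix.det_mul, Matrix.J_det_mul_J_det]
  rcases mul_self_eq_one_iff.1 h with h | h <;> simp [h]

theorem cayley_mul_sub_one (hS_sub : (S - 1).det ≠ 0) :
    cayley S * (S - 1) = (1 / 2 : ℝ) • (stdJ n * (S + 1)) := by
  rw [cayley, smul_mul_assoc, Matrix.nonsing_inv_mul_cancel_right _ _ (isUnit_iff_ne_zero.2 hS_sub)]

/-- Symmetry may be tested after congruence by the invertible `S - 1`. By `SᵀJS = J`, `(S - 1)ᵀJ(S +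
1) = SᵀJ - JS`, which is symmetric because `Jᵀ = -J`. -/
theorem cayley_isHermitian (hS : S ∈ Matrix.symplecticGroup (Fin n) ℝ)
    (hS_sub : (S - 1).det ≠ 0) : (cayley S).IsHermitian := by
  have hu : IsUnit (S - 1) := (Matrix.isUnit_iff_isUnit_det _).2 (isUnit_iff_ne_zero.2 hS_sub)
  have hut : IsUnit (S - 1)ᵀ := by
    rwa [Matrix.isUnit_transpose]
  have hJ : Sᵀ * stdJ n * S = stdJ n := by
    have := SymplecticGroup.mem_iff'.1 hS
    rw [stdJ_eq_neg_J, mul_neg, neg_mul, this]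
  have key : (S - 1)ᵀ * stdJ n * (S + 1) = ((S - 1)ᵀ * stdJ n * (S + 1))ᵀ := by
    simp only [Matrix.transpose_mul, Matrix.transpose_add, Matrix.transpose_sub,
      Matrix.transpose_one, Matrix.transpose_transpose, stdJ_transpose]
    simp only [sub_mul, mul_add, add_mul, mul_sub, neg_mul, mul_neg, one_mul, mul_one,
      ← mul_assoc, hJ]
    abel
  have h : (S - 1)ᵀ * ((cayley S)ᵀ * (S - 1)) = (S - 1)ᵀ * (cayley S * (S - 1)) := by
    rw [cayley_mul_sub_one hS_sub, ← mul_assoc, ← Matrix.transpose_mul,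
      cayley_mul_sub_one hS_sub, Matrix.mul_smul, ← mul_assoc, key]
    simp [Matrix.transpose_mul, mul_assoc]
  rw [Matrix.IsHermitian, Matrix.conjTranspose_eq_transpose_of_trivial]
  exact hu.mul_right_cancel (hut.mul_left_cancel h)

theorem abs_det_cayley (S : PhaseMatrix n) :
    |(cayley S).det| = (1 / 4) ^ n * (|(S + 1).det| / |(S - 1).det|) := by
  rw [cayley, Matrix.det_smul, Matrix.det_mul, Matrix.det_mul, Matrix.det_nonsing_inv,
    Ring.inverse_eq_inv', abs_mul, abs_mul, abs_mul, abs_det_stdJ, abs_inv, one_mul, abs_pow,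
    Fintype.card_sum, Fintype.card_fin, ← two_mul, pow_mul,
    div_eq_mul_inv |(S + 1).det|]
  norm_num

theorem det_cayley_ne_zero (hS_sub : (S - 1).det ≠ 0) (hS_add : (S + 1).det ≠ 0) :
    (cayley S).det ≠ 0 := by
  rw [← abs_pos, abs_det_cayley]
  have := abs_pos.2 hS_sub
  have := abs_pos.2 hS_add
  positivity

theorem cayley_inv_mul_stdJ (hS_sub : (S - 1).det ≠ 0) (hS_add : (S + 1).det ≠ 0) :
    (cayley S)⁻¹ * stdJ n = (2 : ℝ) • ((S - 1) * (S + 1)⁻¹) := by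
  have h : cayley S * ((2 : ℝ) • ((S - 1) * (S + 1)⁻¹)) = stdJ n := by
    rw [Matrix.mul_smul, ← mul_assoc, cayley_mul_sub_one hS_sub, smul_mul_assoc,
      Matrix.mul_nonsing_inv_cancel_right _ _ (isUnit_iff_ne_zero.2 hS_add), smul_smul]
    norm_num
  rw [← h, ← mul_assoc, Matrix.nonsing_inv_mul _
    (isUnit_iff_ne_zero.2 (det_cayley_ne_zero hS_sub hS_add)), one_mul]

/-- Passing to `-S` exchanges `S + 1` and `S - 1` up to sign, so it inverts the Cayley quotient;
this is how `M_{-S}` enters the critical value. -/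
theorem stdJ_mul_cayley_inv_mul_stdJ (hS_sub : (S - 1).det ≠ 0) (hS_add : (S + 1).det ≠ 0) :
    stdJ n * ((cayley S)⁻¹ * stdJ n) = (4 : ℝ) • cayley (-S) := by
  have h : (-S - 1)⁻¹ = -(S + 1)⁻¹ := by
    refine Matrix.inv_eq_left_inv ?_
    rw [← neg_add', neg_mul_neg, Matrix.nonsing_inv_mul _ (isUnit_iff_ne_zero.2 hS_add)]
  rw [cayley_inv_mul_stdJ hS_sub hS_add, cayley, h, show -S + 1 = -(S - 1) by abel, mul_neg,
    mul_neg, neg_mul, neg_neg, smul_smul, Matrix.mul_smul, mul_assoc]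
  norm_num

/-- Completing the square in the phase of `S̃`. -/
theorem cayley_phase_add (hS : S ∈ Matrix.symplecticGroup (Fin n) ℝ)
    (hS_sub : (S - 1).det ≠ 0) (hS_add : (S + 1).det ≠ 0) (z y : PhaseSpace n) :
    let w := ((cayley S)⁻¹ * stdJ n) *ᵥ z
    (cayley S *ᵥ (w + y)) ⬝ᵥ (w + y) - 2 * symplecticForm z (w + y) =
      (cayley S *ᵥ y) ⬝ᵥ y + 4 * ((cayley (-S) *ᵥ z) ⬝ᵥ z) := by
  intro w
  -- The critical point equation of the phase: it cancels the terms linear in `y`.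
  have hw : cayley S *ᵥ w = stdJ n *ᵥ z := by
    rw [Matrix.mulVec_mulVec, ← mul_assoc, Matrix.mul_nonsing_inv _
      (isUnit_iff_ne_zero.2 (det_cayley_ne_zero hS_sub hS_add)), one_mul]
  have hsym : (cayley S *ᵥ y) ⬝ᵥ w = (stdJ n *ᵥ z) ⬝ᵥ y := by
    have hT : (cayley S)ᵀ = cayley S := by
      simpa [Matrix.IsHermitian] using cayley_isHermitian hS hS_sub
    rw [← hw, dotProduct_comm, Matrix.dotProduct_mulVec, ← Matrix.mulVec_transpose, hT]
  have hc : 4 * ((cayley (-S) *ᵥ z) ⬝ᵥ z) = -((stdJ n *ᵥ z) ⬝ᵥ w) := by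
    rw [← smul_eq_mul, ← smul_dotProduct, ← Matrix.smul_mulVec,
      ← stdJ_mul_cayley_inv_mul_stdJ hS_sub hS_add, ← Matrix.mulVec_mulVec, dotProduct_comm,
      Matrix.dotProduct_mulVec, ← Matrix.mulVec_transpose, stdJ_transpose, Matrix.neg_mulVec,
      neg_dotProduct]
  rw [hc, symplecticForm, Matrix.mulVec_add, hw]
  simp only [add_dotProduct, dotProduct_add, hsym]
  ring

/-- Since `|det M_S| = 4⁻ⁿ |det(S + 1)| / |det(S - 1)|`, the factor `|det(S - 1)|` cancels and `2ⁿ`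
appears; `log i = iπ/2` turns the phase into a power of `i`. -/
theorem stationaryPhase_prefactor (hS_sub : (S - 1).det ≠ 0) (hS_add : (S + 1).det ≠ 0) (ν : ℤ) :
    Complex.I ^ ν / (Real.sqrt |(S - 1).det| : ℂ) *
        (Complex.exp (Real.pi * Complex.I / 4 * signature (cayley S)) /
          Real.sqrt |(cayley S).det|) =
      (2 : ℂ) ^ n * Complex.I ^ ((ν : ℂ) + (signature (cayley S) : ℂ) / 2) /
        (Real.sqrt |(S + 1).det| : ℂ) := by
  have h1 : (Real.sqrt |(S - 1).det| : ℂ) ≠ 0 := by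
    exact_mod_cast (Real.sqrt_pos.2 (abs_pos.2 hS_sub)).ne'
  have h2 : (Real.sqrt |(S + 1).det| : ℂ) ≠ 0 := by
    exact_mod_cast (Real.sqrt_pos.2 (abs_pos.2 hS_add)).ne'
  have h3 : Real.sqrt |(cayley S).det| =
      (1 / 2) ^ n * (Real.sqrt |(S + 1).det| / Real.sqrt |(S - 1).det|) := by
    rw [abs_det_cayley, Real.sqrt_mul (by positivity), Real.sqrt_div (abs_nonneg _),
      show (1 / 4 : ℝ) ^ n = ((1 / 2) ^ n) ^ 2 by rw [← pow_mul, mul_comm, pow_mul]; norm_num,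
      Real.sqrt_sq (by positivity)]
  rw [h3, Complex.cpow_add _ _ Complex.I_ne_zero, Complex.cpow_intCast,
    Complex.cpow_def_of_ne_zero Complex.I_ne_zero, Complex.log_I]
  push_cast
  rw [show (Real.pi : ℂ) / 2 * Complex.I * ((signature (cayley S) : ℂ) / 2) =
    Real.pi * Complex.I / 4 * signature (cayley S) by ring, one_div, inv_pow]
  field_simp

end Cayley

/-! ### Reduction of `S̃F(z)` to stationary phase, and conclusion. -/

theorem extendedMetaplectic_eq_integral {n : ℕ} {S : PhaseMatrix n}
    (hS : S ∈ Matrix.symplecticGroup (Fin n) ℝ)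
    (hS_sub : (S - 1).det ≠ 0) (hS_add : (S + 1).det ≠ 0) (ν : ℤ) (F : PhaseSpace n → ℂ)
    (z : PhaseSpace n) {ħ : ℝ} (hħ : 0 < ħ) :
    extendedMetaplectic ħ S ν F z =
      Complex.I ^ ν / (Real.sqrt |(S - 1).det| : ℂ) *
        Complex.exp (2 * Complex.I / (ħ : ℂ) * (((cayley (-S) *ᵥ z) ⬝ᵥ z : ℝ) : ℂ)) *
        ((1 / (Real.sqrt (2 * Real.pi * ħ) : ℂ)) ^ Fintype.card (Fin n ⊕ Fin n) *
          ∫ y : PhaseSpace n,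
            Complex.exp (Complex.I / (2 * (ħ : ℂ)) * (((cayley S *ᵥ y) ⬝ᵥ y : ℝ) : ℂ)) *
              F (z - (1 / 2 : ℝ) • (((cayley S)⁻¹ * stdJ n) *ᵥ z + y))) := by
  have hħ' : (ħ : ℂ) ≠ 0 := by exact_mod_cast hħ.ne'
  -- The integral is over dimension `2n`, so `(2πħ)⁻ⁿ` is exactly the stationary phase
  -- normalization.
  have hpow : ((1 / (2 * Real.pi * ħ) : ℝ) : ℂ) ^ n =
      (1 / (Real.sqrt (2 * Real.pi * ħ) : ℂ)) ^ Fintype.card (Fin n ⊕ Fin n) := by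
    rw [Fintype.card_sum, Fintype.card_fin, ← two_mul, pow_mul, div_pow, one_pow,
      ← Complex.ofReal_pow (Real.sqrt _), Real.sq_sqrt (by positivity)]
    push_cast
    rfl
  rw [extendedMetaplectic, boppOperator, hpow, mul_left_comm]
  congr 1
  rw [← integral_add_left_eq_self _ (((cayley S)⁻¹ * stdJ n) *ᵥ z), ← integral_const_mul]
  refine integral_congr_ae (.of_forall fun y => ?_)
  have h := cayley_phase_add hS hS_sub hS_add z y
  simp only [twistedSymbol, displacement]
  rw [mul_assoc, ← mul_assoc (Complex.exp _), ← Complex.exp_add, mul_assoc _ (Complex.exp _),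
    ← mul_assoc (Complex.exp _), ← Complex.exp_add]
  congr 3
  have h' := congrArg (fun t : ℝ => (t : ℂ)) h
  push_cast at h'
  linear_combination (Complex.I / (2 * (ħ : ℂ))) * h'

end BoppMetaplectic

open BoppMetaplectic in
theorem mainTheorem3 (n : ℕ) (S : BoppMetaplectic.PhaseMatrix n)
    (hS : S ∈ Matrix.symplecticGroup (Fin n) ℝ)
    (hS_sub : (S - 1).det ≠ 0) (hS_add : (S + 1).det ≠ 0) (ν : ℤ)
    (F : BoppMetaplectic.PhaseSpace n → ℂ) (hF : ContDiff ℝ ∞ F) (hF_supp : HasCompactSupport F)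
    (z : BoppMetaplectic.PhaseSpace n) :
    (fun ħ : ℝ =>
      BoppMetaplectic.extendedMetaplectic ħ S ν F z -
        (2 : ℂ) ^ n *
          Complex.I ^ ((ν : ℂ) + (BoppMetaplectic.signature (BoppMetaplectic.cayley S) : ℂ) / 2) /
            (Real.sqrt |(S + 1).det| : ℂ) *
          Complex.exp (2 * Complex.I / (ħ : ℂ) *
            (((BoppMetaplectic.cayley (-S) *ᵥ z) ⬝ᵥ z : ℝ) : ℂ)) *
          F (z - (1 / 2 : ℝ) •
            (((BoppMetaplectic.cayley S)⁻¹ * BoppMetaplectic.stdJ n) *ᵥ z)))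
      =O[𝓝[>] (0 : ℝ)] (fun ħ : ℝ => ħ) := by
  set w := ((cayley S)⁻¹ * stdJ n) *ᵥ z with hw
  -- The map `y ↦ z - (w + y)/2`; composing with a homeomorphism keeps the support compact.
  let e : PhaseSpace n ≃ₜ PhaseSpace n := (Homeomorph.addLeft w).trans
    ((Homeomorph.smulOfNeZero (1 / 2 : ℝ) (by norm_num)).trans (Homeomorph.subLeft z))
  have hg : ContDiff ℝ ∞ fun y : PhaseSpace n => F (z - (1 / 2 : ℝ) • (w + y)) := by fun_prop
  have hg_supp : HasCompactSupport fun y : PhaseSpace n => F (z - (1 / 2 : ℝ) • (w + y)) :=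
    hF_supp.comp_homeomorph e
  have hmain := isBigO_quadratic_stationaryPhase (cayley_isHermitian hS hS_sub)
    (det_cayley_ne_zero hS_sub hS_add) hg hg_supp
  -- The error is this `ħ`-independent constant times a unimodular phase times the stationary phase
  -- error.
  refine (Asymptotics.IsBigO.of_bound ‖Complex.I ^ ν / (Real.sqrt |(S - 1).det| : ℂ)‖ ?_).trans hmain
  filter_upwards [self_mem_nhdsWithin] with ħ (hħ : 0 < ħ)
  rw [extendedMetaplectic_eq_integral hS hS_sub hS_add ν F z hħ,
    ← stationaryPhase_prefactor hS_sub hS_add ν, ← hw, mul_right_comm _ (_ / _) (Complex.exp _),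
    mul_assoc (_ * Complex.exp _) (_ / _), add_zero, ← mul_sub, norm_mul, norm_mul]
  have hnorm : ‖Complex.exp (2 * Complex.I / (ħ : ℂ) *
      (((cayley (-S) *ᵥ z) ⬝ᵥ z : ℝ) : ℂ))‖ = 1 := by
    rw [show 2 * Complex.I / (ħ : ℂ) * (((cayley (-S) *ᵥ z) ⬝ᵥ z : ℝ) : ℂ) =
      ((2 / ħ * ((cayley (-S) *ᵥ z) ⬝ᵥ z) : ℝ) : ℂ) * Complex.I by push_cast; ring]
    exact Complex.norm_exp_ofReal_mul_I _
  rw [hnorm, mul_one]
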